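/- Proposition 6.4. Let $n\ge 0$, write points of $\mathbb R^n\times\mathbb R$ as $(x,t)$, and let $\pi: PT^*(\mathbb R^n\times\mathbb R)\to\mathbb R^n\times\mathbb R$ be the projective cotangent bundle, $PT^*(\mathbb R^n\times\mathbb R)\cong(\mathbb R^n\times\mathbb R)\times P((\mathbb R^n\times\mathbb R)^*)$, with its canonical contact structure $K$: for $p=(z,[\alpha])$, $K_p$ is the set of $w\in T_pPT^*(\mathbb R^n\times\mathbb R)$ with $\alpha(d\pi\, w)=0$. A big Legendrian submanifold is a smooth ($C^\infty$) $n$-dimensional submanifold $L\subset PT^*(\mathbb R^n\times\mathbb R)$ with $T_pL\subset K_p$ for every $p\in L$; its big wave front is $W(L)=\pi(L)$; the regular set of $\pi|_L$ is the set of $p\in L$ at which $d(\pi|_L)_p$ has rank $n$. Let $(L,p_0)$ and $(L',p_0')$ be germs of big Legendrian submanifolds such that the regular set of $\pi|_L$ is dense in $L$ near $p_0$, and the regular set of $\pi|_{L'}$ is dense in $L'$ near $p_0'$. Call a $C^\infty$ diffeomorphism germ $\Phi:(\mathbb R^n\times\mathbb R,\pi(p_0))\to(\mathbb R^n\times\mathbb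 R,\pi(p_0'))$ space-parametrized if it has the form $\Phi(x,t)=(\phi_1(x),\phi_2(x,t))$. Then the following are equivalent. (i) The germs are $s$-$P$-Legendrian equivalent: there is a space-parametrized diffeomorphism germ $\Phi$ whose contact lift $\widehat\Phi(z,[\alpha])=(\Phi(z),[\alpha\circ(d\Phi_z)^{-1}])$ satisfies $\widehat\Phi(p_0)=p_0'$ and $\widehat\Phi(L)=L'$ as set germs at $p_0'$. (ii) The big wave front germs $(W(L),\pi(p_0))$ and $(W(L'),\pi(p_0'))$ are $s$-$P$-diffeomorphic: there is a space-parametrized diffeomorphism germ $\Phi$ with $\Phi(W(L))=W(L')$ as germs at $\pi(p_0')$. Here the equality of front germs in (ii) is understood for arbitrarily small representatives of the Legendrian germs: for all neighbourhoods $V$ of $p_0$ and $V'$ of $p_0'$ there are neighbourhoods $U\subset V$ of $p_0$ and $U'\subset V'$ of $p_0'$ such that $\Phi(\pi(L\cap U))$ and $\pi(L'\cap U')$ have the same set germ at $\pi(p_0')$. When the set germs of $\pi(L\cap U)$ at $\pi(p_0)$ and of $\pi(L'\cap U')$ at $\pi(p_0')$ do not depend on the sufficiently small neighbourhoods $U,U'$,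 this is the equality of these two set germs. -/

import Mathlib

open scoped Topology ContDiff

/-- The quotient topology on a projective space. -/
noncomputable instance BigFront.projectivizationTopology (V : Type*) [NormedAddCommGroup V] [NormedSpace ℝ V] :
    TopologicalSpace (Projectivization ℝ V) :=
  TopologicalSpace.coinduced (Projectivization.mk' ℝ) inferInstance

namespace BigFront

/-- Space-time `ℝⁿ × ℝ`, with points `(x, t)`. -/
abbrev SpaceTime (n : ℕ) : Type := EuclideanSpace ℝ (Fin n) × ℝ

/-- Covectors on `ℝⁿ × ℝ`. -/
abbrev Covector (n : ℕ) : Type := SpaceTime n →L[ℝ] ℝ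

/-- The projective cotangent bundle `PT*(ℝⁿ × ℝ)` in its trivialization
`(ℝⁿ × ℝ) × P((ℝⁿ × ℝ)*)`. A point is a pair `(z, [ξ])`, and the bundle projection `π` is
`Prod.fst`. -/
abbrev PT (n : ℕ) : Type := SpaceTime n × Projectivization ℝ (Covector n)

/-- The map `u ↦ (γ u, [ξ u])` into `PT*(ℝⁿ × ℝ)` with homogeneous coordinates `ξ`. -/
noncomputable def toPT {n : ℕ} (γ : EuclideanSpace ℝ (Fin n) → SpaceTime n)
    (ξ : EuclideanSpace ℝ (Fin n) → {α : Covector n // α ≠ 0}) :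
    EuclideanSpace ℝ (Fin n) → PT n :=
  fun u => (γ u, Projectivization.mk' ℝ (ξ u))

/-- `u ↦ (γ u, [ξ u])`, `u ∈ O ⊆ ℝⁿ`, is a smooth local parametrization around `p`, with parameter
value `u₀` at `p`, of the `n`-dimensional submanifold `L` of `PT*(ℝⁿ × ℝ)`. A map into projective
space is smooth iff it has, locally, smooth nowhere vanishing homogeneous coordinates. -/
structure IsLocalParam {n : ℕ} (L : Set (PT n)) (p : PT n) (O : Set (EuclideanSpace ℝ (Fin n)))
    (u₀ : EuclideanSpace ℝ (Fin n)) (γ : EuclideanSpace ℝ (Fin n) → SpaceTime n)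
    (ξ : EuclideanSpace ℝ (Fin n) → {α : Covector n // α ≠ 0}) : Prop where
  isOpen : IsOpen O
  mem : u₀ ∈ O
  map_eq : toPT γ ξ u₀ = p
  smooth_base : ContDiffOn ℝ ∞ γ O
  smooth_covector : ContDiffOn ℝ ∞ (fun u => (ξ u : Covector n)) O
  /-- `toPT γ ξ` is an immersion: the kernel of the differential of `α ↦ [α]` at `α` is the
  line spanned by `α`. -/
  immersion : ∀ u ∈ O, ∀ v, fderiv ℝ γ u v = 0 →
    (∃ c : ℝ, fderiv ℝ (fun u => (ξ u : Covector n)) u v = c • (ξ u : Covector n)) → v = 0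
  /-- `toPT γ ξ` is a homeomorphism of `O` onto its image. -/
  embedding : Topology.IsEmbedding (O.domRestrict (toPT γ ξ))
  /-- The image of `O` is a relatively open subset of `L`. -/
  image_eq : ∃ V : Set (PT n), IsOpen V ∧ toPT γ ξ '' O = L ∩ V

/-- `L` is a big Legendrian submanifold of `PT*(ℝⁿ × ℝ)`: a smooth `n`-dimensional submanifold
tangent to the canonical contact structure, whose hyperplane at `p = (z, [α])` is
`K_p = {w ∈ T_p PT* | α (dπ w) = 0}`. -/
def IsBigLegendrian {n : ℕ} (L : Set (PT n)) : Prop :=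
  ∀ p ∈ L, ∃ O u₀ γ ξ, IsLocalParam L p O u₀ γ ξ ∧
    ∀ u ∈ O, ∀ v, (ξ u : Covector n) (fderiv ℝ γ u v) = 0

/-- The regular set of the Legendrian map `π|_L`: the points `p` where `d(π|_L)_p` has rank
`n = dim L`, i.e. is injective. -/
def regularSet {n : ℕ} (L : Set (PT n)) : Set (PT n) :=
  {p | p ∈ L ∧ ∃ O u₀ γ ξ, IsLocalParam L p O u₀ γ ξ ∧ Function.Injective (fderiv ℝ γ u₀)}

/-- The regular set of `π|_L` is dense in the germ `(L, p₀)`. -/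
def RegularDenseAt {n : ℕ} (L : Set (PT n)) (p₀ : PT n) : Prop :=
  ∃ U ∈ 𝓝 p₀, L ∩ U ⊆ closure (regularSet L)

/-- `A` and `B` have the same set germ at `a`. -/
def SameGerm {X : Type*} [TopologicalSpace X] (a : X) (A B : Set X) : Prop :=
  ∀ᶠ z in 𝓝 a, z ∈ A ↔ z ∈ B

/-- `Φ` represents a diffeomorphism germ `(ℝⁿ × ℝ, q) → (ℝⁿ × ℝ, q')` of the space-parametrized
form `Φ (x, t) = (φ₁ x, φ₂ (x, t))`. -/
structure IsSPDiffeoGerm {n : ℕ} (Φ : OpenPartialHomeomorph (SpaceTime n) (SpaceTime n))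
    (q q' : SpaceTime n) : Prop where
  mem_source : q ∈ Φ.source
  map_eq : Φ q = q'
  contDiffOn : ContDiffOn ℝ ∞ Φ Φ.source
  contDiffOn_symm : ContDiffOn ℝ ∞ Φ.symm Φ.target
  spaceParametrized : ∃ (φ₁ : EuclideanSpace ℝ (Fin n) → EuclideanSpace ℝ (Fin n))
    (φ₂ : EuclideanSpace ℝ (Fin n) × ℝ → ℝ),
    ∀ x t, (x, t) ∈ Φ.source → Φ (x, t) = (φ₁ x, φ₂ (x, t))

open Classical in
/-- The contact lift of a diffeomorphism `Φ` between open subsets of `ℝⁿ × ℝ`, over `Φ.source`: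
`(z, [α]) ↦ (Φ z, [α ∘ (dΦ_z)⁻¹])`. See `contactLift_mk`; the `else` branch is never used
over `Φ.source`. -/
noncomputable def contactLift {n : ℕ} (Φ : OpenPartialHomeomorph (SpaceTime n) (SpaceTime n))
    (p : PT n) : PT n :=
  if h : p.2.rep.comp (fderiv ℝ Φ.symm (Φ p.1)) ≠ 0 then
    (Φ p.1, Projectivization.mk ℝ (p.2.rep.comp (fderiv ℝ Φ.symm (Φ p.1))) h)
  else p

lemma fderiv_symm_comp_fderiv {n : ℕ} {Φ : OpenPartialHomeomorph (SpaceTime n) (SpaceTime n)}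
    {q q' : SpaceTime n} (hΦ : IsSPDiffeoGerm Φ q q') {z : SpaceTime n} (hz : z ∈ Φ.source) :
    (fderiv ℝ Φ.symm (Φ z)).comp (fderiv ℝ Φ z) = ContinuousLinearMap.id ℝ (SpaceTime n) := by
  have h1 : DifferentiableAt ℝ Φ z :=
    (hΦ.contDiffOn.contDiffAt (Φ.open_source.mem_nhds hz)).differentiableAt (by simp)
  have h2 : DifferentiableAt ℝ Φ.symm (Φ z) :=
    (hΦ.contDiffOn_symm.contDiffAt (Φ.open_target.mem_nhds (Φ.map_source hz))).differentiableAt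
      (by simp)
  rw [← fderiv_comp z h2 h1]
  have : (Φ.symm ∘ Φ) =ᶠ[𝓝 z] id := by
    filter_upwards [Φ.open_source.mem_nhds hz] with w hw using Φ.left_inv hw
  rw [this.fderiv_eq, fderiv_id]

lemma comp_fderiv_symm_ne_zero {n : ℕ}
    {Φ : OpenPartialHomeomorph (SpaceTime n) (SpaceTime n)} {q q' : SpaceTime n}
    (hΦ : IsSPDiffeoGerm Φ q q') {z : SpaceTime n} (hz : z ∈ Φ.source) {α : Covector n}
    (hα : α ≠ 0) : α.comp (fderiv ℝ Φ.symm (Φ z)) ≠ 0 := by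
  intro h
  apply hα
  have h' := congrArg (fun β : Covector n => β.comp (fderiv ℝ Φ z)) h
  simpa [ContinuousLinearMap.comp_assoc, fderiv_symm_comp_fderiv hΦ hz] using h'

/-- The contact lift does not depend on the representative of the covector direction. -/
lemma contactLift_mk {n : ℕ} {Φ : OpenPartialHomeomorph (SpaceTime n) (SpaceTime n)}
    {q q' : SpaceTime n} (hΦ : IsSPDiffeoGerm Φ q q') {z : SpaceTime n} (hz : z ∈ Φ.source)
    {α : Covector n} (hα : α ≠ 0) :
    contactLift Φ (z, Projectivization.mk ℝ α hα) =
      (Φ z, Projectivization.mk ℝ (α.comp (fderiv ℝ Φ.symm (Φ z)))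
        (comp_fderiv_symm_ne_zero hΦ hz hα)) := by
  have h := comp_fderiv_symm_ne_zero hΦ hz (Projectivization.mk ℝ α hα).rep_nonzero
  rw [contactLift, dif_pos h]
  obtain ⟨a, ha⟩ := Projectivization.exists_smul_eq_mk_rep ℝ α hα
  refine Prod.ext rfl ((Projectivization.mk_eq_mk_iff ℝ _ _ _ _).2 ⟨a, ?_⟩)
  simp only [← ha]
  ext <;> simp

/-- Space-parametrized Legendrian equivalence of the germs `(L, p₀)` and `(L', p₀')`: the contact
lift `Φ̂` of a diffeomorphism germ `Φ` of the space-parametrized form satisfies `Φ̂ p₀ = p₀'` and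
`Φ̂ L = L'` as set germs at `p₀'`. -/
def SPLegendrianEquivalent {n : ℕ} (L : Set (PT n)) (p₀ : PT n) (L' : Set (PT n)) (p₀' : PT n) :
    Prop :=
  ∃ Φ : OpenPartialHomeomorph (SpaceTime n) (SpaceTime n), IsSPDiffeoGerm Φ p₀.1 p₀'.1 ∧
    contactLift Φ p₀ = p₀' ∧
    SameGerm p₀' (contactLift Φ '' (L ∩ {p | p.1 ∈ Φ.source})) L'

/-- The big wave front `W(L) = π(L)`. -/
def bigWaveFront {n : ℕ} (L : Set (PT n)) : Set (SpaceTime n) := Prod.fst '' L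

/-- The big wave front germs of `(L, p₀)` and `(L', p₀')` are space-parametrized diffeomorphic:
there is a diffeomorphism germ `Φ` of the space-parametrized form such that `Φ (W(L)) = W(L')` as
set germs at `π(p₀')`.

Here `L` and `L'` stand for germs, so they may be replaced by arbitrarily small representatives
`L ∩ U` and `L' ∩ U'`; the equality is required for arbitrarily small representatives. If the set
germ of `W(L ∩ U)` at `π(p₀)` is the same for all small neighbourhoods `U` of `p₀` (as it is when
`p₀` is isolated in its fibre), and likewise for `L'`, this is equality of these two set germs. -/
def FrontsSPDiffeomorphic {n : ℕ} (L : Set (PT n)) (p₀ : PT n) (L' : Set (PT n)) (p₀' : PT n) :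
    Prop :=
  ∃ Φ : OpenPartialHomeomorph (SpaceTime n) (SpaceTime n), IsSPDiffeoGerm Φ p₀.1 p₀'.1 ∧
    ∀ V ∈ 𝓝 p₀, ∀ V' ∈ 𝓝 p₀', ∃ U ∈ 𝓝 p₀, ∃ U' ∈ 𝓝 p₀', U ⊆ V ∧ U' ⊆ V' ∧
      SameGerm p₀'.1 (Φ '' (bigWaveFront (L ∩ U) ∩ Φ.source)) (bigWaveFront (L' ∩ U'))

end BigFront

/-!
By a version of Sard's theorem, a contact element of `L'` over a point `γ u` of a parametrized
hypersurface `γ` is, for almost every `u`, tangent to `γ`. Over a regular point of `L` the front is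
such a hypersurface, and so is its image under `Φ`. Hence over the images of almost all points
nearby, if `Φ` maps the front of `L` into that of `L'`, there is exactly one contact element of
`L'`, namely the contact lift of the one of `L`. As the regular set is dense and `L'` is locally
closed, the contact lift maps the whole germ of `L` into that of `L'`; the argument for the inverse
of `Φ` gives equality.

Sard's theorem is applied to the map `w ↦ u` defined by `γ' w = γ u` on the set of those `w` at
which the front `γ'` of a chart of `L'` crosses `γ` transversally. Where `w` is not already critical, this set lies
in the zero set of a function whose differential at `w` is nonzero, which gives the map a singular
derivative within the set.
-/

open Filter Set MeasureTheory

namespace BigFront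

lemma tendsto_nhdsWithin_of_closure_mem {X Y : Type*} [TopologicalSpace X] [TopologicalSpace Y]
    {f : X → Y} {x : X} {A R : Set X} {l : Filter Y} (hl : ∀ S ∈ l, ∃ C ∈ l, IsClosed C ∧ C ⊆ S)
    (hf : ∀ᶠ p in 𝓝 x, ContinuousAt f p) (hR : closure R ∈ 𝓝[A] x) (h : Tendsto f (𝓝[R] x) l) :
    Tendsto f (𝓝[A] x) l := by
  intro S hS
  obtain ⟨C, hC, hC_closed, hCS⟩ := hl S hS
  obtain ⟨N, hN, hN_open, hxN⟩ :=
    eventually_nhds_iff.1 (hf.and (eventually_nhdsWithin_iff.1 (h.eventually_mem hC)))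
  change f ⁻¹' S ∈ 𝓝[A] x
  filter_upwards [hR, mem_nhdsWithin_of_mem_nhds (hN_open.mem_nhds hxN)] with p hpR hpN
  have hp : p ∈ closure (N ∩ R) := hN_open.inter_closure ⟨hpN, hpR⟩
  exact hCS (hC_closed.closure_subset ((hN p hpN).1.continuousWithinAt.mem_closure hp
    fun q hq => (hN q hq.1).2 hq.2))

instance neBot_nhds_inf_ae {X : Type*} [TopologicalSpace X] [MeasurableSpace X] (μ : Measure X)
    [μ.IsOpenPosMeasure] (x : X) : (𝓝 x ⊓ ae μ).NeBot := by
  refine inf_neBot_iff_frequently_right.2 fun {P} hP => ?_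
  exact mem_closure_iff_frequently.1 (Measure.dense_of_ae hP x)

section Sard

variable {E F : Type*} [NormedAddCommGroup E] [NormedSpace ℝ E] [NormedAddCommGroup F]
  [NormedSpace ℝ F]

lemma exists_contDiffAt_leftInverse [CompleteSpace E] {γ : E → F} {u₀ : E} {m : WithTop ℕ∞}
    (hm : m ≠ 0) (hγ : ContDiffAt ℝ m γ u₀) {a : F →L[ℝ] E}
    (ha : a ∘L fderiv ℝ γ u₀ = .id ℝ E) :
    ∃ r : F → E, ContDiffAt ℝ m r (γ u₀) ∧ ∀ᶠ u in 𝓝 u₀, r (γ u) = u := by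
  have haγ : ContDiffAt ℝ m (a ∘ γ) u₀ := a.contDiff.contDiffAt.comp u₀ hγ
  have haγ' : HasFDerivAt (a ∘ γ) (ContinuousLinearEquiv.refl ℝ E : E →L[ℝ] E) u₀ := by
    have := a.hasFDerivAt.comp u₀ (hγ.differentiableAt hm).hasFDerivAt
    rwa [ha] at this
  exact ⟨haγ.localInverse haγ' hm ∘ a,
    (haγ.to_localInverse haγ' hm).comp (γ u₀) a.contDiff.contDiffAt,
    (haγ.hasStrictFDerivAt' haγ' hm).eventually_left_inverse⟩

variable [FiniteDimensional ℝ E]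

/-- A derivative within a thin set is not unique: adding to `f` a vector multiple of `h`, which
vanishes on `s`, changes the derivative by an operator of rank one. -/
lemma exists_hasFDerivWithinAt_det_eq_zero {f : E → E} {h : E → ℝ} {s : Set E} {x : E}
    {A : E →L[ℝ] E} {ℓ : E →L[ℝ] ℝ} (hf : HasFDerivWithinAt f A s x)
    (hh : HasFDerivWithinAt h (ℓ ∘L A) s x) (hs : ∀ y ∈ s, h y = 0) (hx : x ∈ s) (hℓ : ℓ ≠ 0) :
    ∃ B : E →L[ℝ] E, HasFDerivWithinAt f B s x ∧ B.det = 0 := by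
  obtain ⟨c, hc⟩ := ContinuousLinearMap.exists_ne_zero hℓ
  let P : E →L[ℝ] E := .id ℝ E - ℓ.smulRight ((ℓ c)⁻¹ • c)
  have hPc : P c = 0 := by simp [P, hc]
  have hP : P.det = 0 := by
    by_contra hdet
    refine hc ?_
    rw [(P.toContinuousLinearEquivOfDetNeZero hdet).injective (hPc.trans (map_zero P).symm),
      map_zero]
  refine ⟨P ∘L A, ?_, ?_⟩
  · refine ((hf.sub (hh.smul_const ((ℓ c)⁻¹ • c))).congr (fun y hy => ?_) ?_).congr_fderiv ?_
    · simp [hs y hy]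
    · simp [hs x hx]
    · ext v
      simp [P]
  · exact (LinearMap.det_comp (P : E →ₗ[ℝ] E) (A : E →ₗ[ℝ] E)).trans (mul_eq_zero_of_left hP _)

variable [MeasurableSpace E] [BorelSpace E] (μ : Measure E) [μ.IsAddHaarMeasure]

lemma ae_comp_fderiv_eq_zero_of_leftInverse {γ γ' : E → F} {r : F → E} {O : Set E}
    {β : E → F →L[ℝ] ℝ} (hγ' : ∀ w ∈ O, DifferentiableAt ℝ γ' w)
    (hβ : ∀ w ∈ O, β w ∘L fderiv ℝ γ' w = 0) :
    ∀ᵐ u ∂μ, DifferentiableAt ℝ γ u → DifferentiableAt ℝ r (γ u) → r (γ u) = u →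
      ∀ w ∈ O, γ' w = γ u → β w ∘L fderiv ℝ γ u = 0 := by
  let f : E → E := r ∘ γ'
  let s : Set E := {w | w ∈ O ∧ γ' w = γ (f w) ∧ DifferentiableAt ℝ γ (f w) ∧
    DifferentiableAt ℝ r (γ (f w)) ∧ β w ∘L fderiv ℝ γ (f w) ≠ 0}
  have hs : ∀ w ∈ s, ∃ B : E →L[ℝ] E, HasFDerivWithinAt f B s w ∧ B.det = 0 := by
    rintro w hw
    obtain ⟨hwO, hγw, hγ, hr, hne⟩ := id hw
    have hf : HasFDerivAt f (fderiv ℝ f w) w := by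
      rw [← hγw] at hr
      exact (hr.comp w (hγ' w hwO)).hasFDerivAt
    have hh : HasFDerivAt (fun y => β w (γ (f y)) - β w (γ' y))
        ((β w ∘L fderiv ℝ γ (f w)) ∘L fderiv ℝ f w) w := by
      have h := ((β w).hasFDerivAt.comp w (hγ.hasFDerivAt.comp w hf)).sub
        ((β w).hasFDerivAt.comp w (hγ' w hwO).hasFDerivAt)
      rwa [hβ w hwO, sub_zero] at h
    refine exists_hasFDerivWithinAt_det_eq_zero hf.hasFDerivWithinAt hh.hasFDerivWithinAt
      (fun y hy => ?_) hw hne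
    rw [← hy.2.1, sub_self]
  choose! B hB hdet using hs
  have hnull : μ (f '' s) = 0 := addHaar_image_eq_zero_of_det_fderivWithin_eq_zero μ hB hdet
  filter_upwards [measure_eq_zero_iff_ae_notMem.1 hnull] with u hu hγ hr hru w hwO hwu
  by_contra hne
  have hfw : f w = u := (congrArg r hwu).trans hru
  exact hu ⟨w, ⟨hwO, by rwa [hfw], by rwa [hfw], by rwa [hfw], by rwa [hfw]⟩, hfw⟩

end Sard

lemma exists_smul_eq_of_comp_eq_zero {𝕜 E F : Type*} [Field 𝕜] [AddCommGroup E] [Module 𝕜 E]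
    [AddCommGroup F] [Module 𝕜 F] [FiniteDimensional 𝕜 F]
    (hdim : Module.finrank 𝕜 F = Module.finrank 𝕜 E + 1) {A : E →ₗ[𝕜] F}
    (hA : Function.Injective A) {α β : Module.Dual 𝕜 F} (hβ : β ≠ 0) (hαA : α ∘ₗ A = 0)
    (hβA : β ∘ₗ A = 0) : ∃ c : 𝕜, c • β = α := by
  have hfinrank : Module.finrank 𝕜 A.range.dualAnnihilator = 1 := by
    have := Subspace.finrank_add_finrank_dualAnnihilator_eq A.range
    rw [LinearMap.finrank_range_of_inj hA] at this
    omega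
  have hmem : ∀ δ : Module.Dual 𝕜 F, δ ∘ₗ A = 0 → δ ∈ A.range.dualAnnihilator := by
    rintro δ hδ
    rw [Submodule.mem_dualAnnihilator]
    rintro _ ⟨v, rfl⟩
    exact LinearMap.congr_fun hδ v
  obtain ⟨c, hc⟩ := exists_smul_eq_of_finrank_eq_one hfinrank
    (x := (⟨β, hmem β hβA⟩ : A.range.dualAnnihilator)) (by simpa using hβ)
    (⟨α, hmem α hαA⟩ : A.range.dualAnnihilator)
  exact ⟨c, congrArg Subtype.val hc⟩

section Projectivization

variable {V : Type*} [NormedAddCommGroup V] [NormedSpace ℝ V]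

lemma isOpenQuotientMap_mk' :
    IsOpenQuotientMap (Projectivization.mk' ℝ : {v : V // v ≠ 0} → Projectivization ℝ V) := by
  have hq : Topology.IsQuotientMap
      (Projectivization.mk' ℝ : {v : V // v ≠ 0} → Projectivization ℝ V) :=
    ⟨⟨rfl⟩, Quotient.mk''_surjective⟩
  refine ⟨hq.surjective, hq.continuous, fun s hs => ?_⟩
  have hunion : Projectivization.mk' ℝ ⁻¹' (Projectivization.mk' ℝ '' s) =
      ⋃ a : ℝˣ, (fun v : {v : V // v ≠ 0} =>
        (⟨a • (v : V), (smul_ne_zero_iff_ne a).2 v.2⟩ : {v : V // v ≠ 0})) ⁻¹' s := by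
    ext v
    simp only [mem_preimage, mem_image, mem_iUnion]
    constructor
    · rintro ⟨w, hw, hwv⟩
      obtain ⟨a, ha⟩ := (Projectivization.mk_eq_mk_iff ℝ _ _ w.2 v.2).1 hwv
      exact ⟨a, by convert hw⟩
    · rintro ⟨a, ha⟩
      exact ⟨_, ha, (Projectivization.mk_eq_mk_iff ℝ _ _ _ v.2).2 ⟨a, rfl⟩⟩
  rw [← hq.isOpen_preimage, hunion]
  exact isOpen_iUnion fun a =>
    hs.preimage ((continuous_subtype_val.const_smul (a : ℝ)).subtype_mk _)

instance : T2Space (Projectivization ℝ V) := by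
  rw [t2Space_iff_of_isOpenQuotientMap isOpenQuotientMap_mk']
  have hset : {q : {v : V // v ≠ 0} × {v : V // v ≠ 0} |
      Projectivization.mk' ℝ q.1 = Projectivization.mk' ℝ q.2} =
      ⋂ f : StrongDual ℝ V, {q | f q.2 • (q.1 : V) = f q.1 • (q.2 : V)} := by
    ext ⟨v, w⟩
    simp only [mem_ofPred_eq, mem_iInter]
    refine (Projectivization.mk_eq_mk_iff' ℝ _ _ v.2 w.2).trans ⟨?_, fun h => ?_⟩
    · rintro ⟨a, ha⟩ f
      rw [← ha, map_smul, smul_comm, smul_assoc]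
    · obtain ⟨f, hf⟩ := SeparatingDual.exists_ne_zero (R := ℝ) w.2
      exact ⟨(f w)⁻¹ * f v, by rw [mul_smul, ← h f, inv_smul_smul₀ hf]⟩
  rw [hset]
  exact isClosed_iInter fun f => isClosed_eq (by fun_prop) (by fun_prop)

instance [SecondCountableTopology V] : SecondCountableTopology (Projectivization ℝ V) :=
  isOpenQuotientMap_mk'.isQuotientMap.secondCountableTopology isOpenQuotientMap_mk'.isOpenMap

end Projectivization

variable {n : ℕ} {Φ : OpenPartialHomeomorph (SpaceTime n) (SpaceTime n)}

/-- `Φ` is a `C¹` diffeomorphism between open subsets of `ℝⁿ × ℝ`, the regularity at which its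
contact lift is a homeomorphism. -/
structure IsC1Diffeo (Φ : OpenPartialHomeomorph (SpaceTime n) (SpaceTime n)) : Prop where
  contDiffOn : ContDiffOn ℝ 1 Φ Φ.source
  contDiffOn_symm : ContDiffOn ℝ 1 Φ.symm Φ.target

lemma IsSPDiffeoGerm.isC1Diffeo {q q' : SpaceTime n} (hΦ : IsSPDiffeoGerm Φ q q') :
    IsC1Diffeo Φ :=
  ⟨hΦ.contDiffOn.of_le (by simp), hΦ.contDiffOn_symm.of_le (by simp)⟩

namespace IsC1Diffeo

lemma symm (hΦ : IsC1Diffeo Φ) : IsC1Diffeo Φ.symm := ⟨hΦ.contDiffOn_symm, hΦ.contDiffOn⟩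

lemma contDiffAt (hΦ : IsC1Diffeo Φ) {z : SpaceTime n} (hz : z ∈ Φ.source) :
    ContDiffAt ℝ 1 Φ z :=
  hΦ.contDiffOn.contDiffAt (Φ.open_source.mem_nhds hz)

lemma differentiableAt (hΦ : IsC1Diffeo Φ) {z : SpaceTime n} (hz : z ∈ Φ.source) :
    DifferentiableAt ℝ Φ z :=
  (hΦ.contDiffAt hz).differentiableAt one_ne_zero

lemma fderiv_symm_comp_fderiv (hΦ : IsC1Diffeo Φ) {z : SpaceTime n} (hz : z ∈ Φ.source) :
    fderiv ℝ Φ.symm (Φ z) ∘L fderiv ℝ Φ z = .id ℝ (SpaceTime n) := by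
  have hid : Φ.symm ∘ Φ =ᶠ[𝓝 z] id := Φ.eventually_left_inverse hz
  rw [← fderiv_comp z (hΦ.symm.differentiableAt (Φ.map_source hz)) (hΦ.differentiableAt hz),
    hid.fderiv_eq, fderiv_id]

lemma injective_fderiv (hΦ : IsC1Diffeo Φ) {z : SpaceTime n} (hz : z ∈ Φ.source) :
    Function.Injective (fderiv ℝ Φ z) :=
  Function.LeftInverse.injective (g := fderiv ℝ Φ.symm (Φ z))
    (DFunLike.congr_fun (hΦ.fderiv_symm_comp_fderiv hz))

lemma comp_fderiv_symm_ne_zero (hΦ : IsC1Diffeo Φ) {z : SpaceTime n} (hz : z ∈ Φ.source)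
    {α : Covector n} (hα : α ≠ 0) : α ∘L fderiv ℝ Φ.symm (Φ z) ≠ 0 := by
  intro h
  apply hα
  rw [← α.comp_id, ← hΦ.fderiv_symm_comp_fderiv hz, ← ContinuousLinearMap.comp_assoc, h,
    ContinuousLinearMap.zero_comp]

lemma contactLift_mk (hΦ : IsC1Diffeo Φ) {z : SpaceTime n} (hz : z ∈ Φ.source)
    {α : Covector n} (hα : α ≠ 0) :
    contactLift Φ (z, Projectivization.mk ℝ α hα) =
      (Φ z, Projectivization.mk ℝ (α ∘L fderiv ℝ Φ.symm (Φ z))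
        (hΦ.comp_fderiv_symm_ne_zero hz hα)) := by
  have h := hΦ.comp_fderiv_symm_ne_zero hz (Projectivization.mk ℝ α hα).rep_nonzero
  rw [contactLift, dif_pos h]
  obtain ⟨a, ha⟩ := Projectivization.exists_smul_eq_mk_rep ℝ α hα
  refine Prod.ext rfl ((Projectivization.mk_eq_mk_iff ℝ _ _ _ _).2 ⟨a, ?_⟩)
  rw [← ha]
  rfl

lemma contactLift_fst (hΦ : IsC1Diffeo Φ) {p : PT n} (hp : p.1 ∈ Φ.source) :
    (contactLift Φ p).1 = Φ p.1 := by
  obtain ⟨z, a⟩ := p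
  induction a using Projectivization.ind with
  | h α hα => rw [hΦ.contactLift_mk hp hα]

lemma contactLift_symm_contactLift (hΦ : IsC1Diffeo Φ) {p : PT n} (hp : p.1 ∈ Φ.source) :
    contactLift Φ.symm (contactLift Φ p) = p := by
  obtain ⟨z, a⟩ := p
  induction a using Projectivization.ind with
  | h α hα =>
    have hz : z ∈ Φ.source := hp
    rw [hΦ.contactLift_mk hz hα, hΦ.symm.contactLift_mk (Φ.map_source hz)]
    simp only [Φ.symm_symm, Φ.left_inv hz, ContinuousLinearMap.comp_assoc,
      hΦ.fderiv_symm_comp_fderiv hz, ContinuousLinearMap.comp_id]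

lemma continuousOn_contactLift (hΦ : IsC1Diffeo Φ) :
    ContinuousOn (contactLift Φ) (Prod.fst ⁻¹' Φ.source) := by
  let π : SpaceTime n × {α : Covector n // α ≠ 0} → PT n := Prod.map id (Projectivization.mk' ℝ)
  have hπ : IsOpenQuotientMap π := .prodMap .id isOpenQuotientMap_mk'
  have hbase : Continuous fun q : π ⁻¹' (Prod.fst ⁻¹' Φ.source) => Φ q.1.1 :=
    Φ.continuousOn.comp_continuous (by fun_prop) fun q => q.2
  have hderiv : Continuous fun q : π ⁻¹' (Prod.fst ⁻¹' Φ.source) => fderiv ℝ Φ.symm (Φ q.1.1) :=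
    (hΦ.contDiffOn_symm.continuousOn_fderiv_of_isOpen Φ.open_target le_rfl).comp_continuous hbase
      fun q => Φ.map_source q.2
  rw [continuousOn_iff_continuous_domRestrict,
    ← (hπ.restrictPreimage (Prod.fst ⁻¹' Φ.source)).continuous_comp_iff]
  have hcovector : Continuous fun q : π ⁻¹' (Prod.fst ⁻¹' Φ.source) =>
      (q.1.2 : Covector n) ∘L fderiv ℝ Φ.symm (Φ q.1.1) :=
    .clm_comp (by fun_prop) hderiv
  refine (hπ.continuous.comp (hbase.prodMk (hcovector.subtype_mk fun q =>
    hΦ.comp_fderiv_symm_ne_zero q.2 q.1.2.2))).congr fun q => ?_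
  exact (hΦ.contactLift_mk q.2 q.1.2.2).symm

/-- The contact lift `Φ̂` as a homeomorphism from the part of `PT*(ℝⁿ × ℝ)` over the source of `Φ`
onto the part over its target. -/
noncomputable def contactLiftHomeomorph (hΦ : IsC1Diffeo Φ) :
    OpenPartialHomeomorph (PT n) (PT n) where
  toFun := contactLift Φ
  invFun := contactLift Φ.symm
  source := Prod.fst ⁻¹' Φ.source
  target := Prod.fst ⁻¹' Φ.target
  map_source' p hp := by
    rw [mem_preimage, hΦ.contactLift_fst hp]
    exact Φ.map_source hp
  map_target' p hp := by
    rw [mem_preimage, hΦ.symm.contactLift_fst hp]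
    exact Φ.map_target hp
  left_inv' p hp := hΦ.contactLift_symm_contactLift hp
  right_inv' p hp := hΦ.symm.contactLift_symm_contactLift hp
  open_source := Φ.open_source.preimage continuous_fst
  open_target := Φ.open_target.preimage continuous_fst
  continuousOn_toFun := hΦ.continuousOn_contactLift
  continuousOn_invFun := hΦ.symm.continuousOn_contactLift

end IsC1Diffeo

/-- The hyperplane given by the contact element `p = (z, [α])` contains the range of `A`. For
`A = dγ_u` and `z = γ u` this says that `p` is tangent to the parametrized hypersurface `γ`. -/
def IsConormal {E : Type*} [NormedAddCommGroup E] [NormedSpace ℝ E] (p : PT n)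
    (A : E →L[ℝ] SpaceTime n) : Prop :=
  p.2.rep ∘L A = 0

section IsConormal

variable {E : Type*} [NormedAddCommGroup E] [NormedSpace ℝ E] {A : E →L[ℝ] SpaceTime n}

lemma isConormal_mk {z : SpaceTime n} {α : Covector n} (hα : α ≠ 0) :
    IsConormal (z, Projectivization.mk ℝ α hα) A ↔ α ∘L A = 0 := by
  obtain ⟨a, ha⟩ := Projectivization.exists_smul_eq_mk_rep ℝ α hα
  have hsmul : (a • α) ∘L A = a • α ∘L A := rfl
  rw [IsConormal, ← ha, hsmul, smul_eq_zero_iff_eq]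

lemma IsConormal.contactLift {p : PT n} (h : IsConormal p A) (hΦ : IsC1Diffeo Φ)
    (hp : p.1 ∈ Φ.source) : IsConormal (contactLift Φ p) (fderiv ℝ Φ p.1 ∘L A) := by
  obtain ⟨z, a⟩ := p
  induction a using Projectivization.ind with
  | h α hα =>
    rw [isConormal_mk] at h
    rwa [hΦ.contactLift_mk hp hα, isConormal_mk, ContinuousLinearMap.comp_assoc,
      ← ContinuousLinearMap.comp_assoc _ _ A, hΦ.fderiv_symm_comp_fderiv hp,
      ContinuousLinearMap.id_comp]

lemma IsConormal.eq {p q : PT n} (hp : IsConormal p A) (hq : IsConormal q A)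
    (hdim : Module.finrank ℝ E = n) (hA : Function.Injective A) (hpq : p.1 = q.1) : p = q := by
  obtain ⟨c, hc⟩ := exists_smul_eq_of_comp_eq_zero (A := (A : E →ₗ[ℝ] SpaceTime n))
    (α := (p.2.rep : SpaceTime n →ₗ[ℝ] ℝ)) (β := (q.2.rep : SpaceTime n →ₗ[ℝ] ℝ)) (by simp [hdim])
    hA (fun h => q.2.rep_nonzero (ContinuousLinearMap.coe_injective h))
    (congrArg ContinuousLinearMap.toLinearMap hp) (congrArg ContinuousLinearMap.toLinearMap hq)
  refine Prod.ext hpq ?_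
  rw [← p.2.mk_rep, ← q.2.mk_rep, Projectivization.mk_eq_mk_iff']
  exact ⟨c, ContinuousLinearMap.coe_injective hc⟩

end IsConormal

variable {L L' : Set (PT n)} {p p₀ p₀' : PT n}

namespace IsLocalParam

variable {O : Set (EuclideanSpace ℝ (Fin n))} {u₀ : EuclideanSpace ℝ (Fin n)}
  {γ : EuclideanSpace ℝ (Fin n) → SpaceTime n}
  {ξ : EuclideanSpace ℝ (Fin n) → {α : Covector n // α ≠ 0}}

lemma contDiffAt_base (h : IsLocalParam L p O u₀ γ ξ) {u : EuclideanSpace ℝ (Fin n)} (hu : u ∈ O) :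
    ContDiffAt ℝ 1 γ u :=
  (h.smooth_base.contDiffAt (h.isOpen.mem_nhds hu)).of_le (by simp)

lemma map_toPT_nhds (h : IsLocalParam L p O u₀ γ ξ) : map (toPT γ ξ) (𝓝 u₀) = 𝓝[L] p := by
  obtain ⟨V, hV, hOV⟩ := h.image_eq
  have hpV : p ∈ V := (hOV.subset ⟨u₀, h.mem, h.map_eq⟩).2
  rw [← map_nhds_subtype_coe_eq_nhds h.mem (h.isOpen.mem_nhds h.mem), map_map]
  change map (O.domRestrict (toPT γ ξ)) (𝓝 ⟨u₀, h.mem⟩) = _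
  rw [h.embedding.isInducing.map_nhds_eq, range_domRestrict, hOV, domRestrict_apply, h.map_eq,
    nhdsWithin_inter_of_mem' (mem_nhdsWithin_of_mem_nhds (hV.mem_nhds hpV))]

lemma exists_isClosed_subset (h : IsLocalParam L p O u₀ γ ξ) {S : Set (PT n)} (hS : S ∈ 𝓝[L] p) :
    ∃ C ∈ 𝓝[L] p, IsClosed C ∧ C ⊆ S := by
  rw [← h.map_toPT_nhds, mem_map] at hS
  obtain ⟨K, hK, hKsub, hK_compact⟩ :=
    local_compact_nhds (inter_mem hS (h.isOpen.mem_nhds h.mem))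
  have hcont : ContinuousOn (toPT γ ξ) O :=
    continuousOn_iff_continuous_domRestrict.2 h.embedding.continuous
  refine ⟨toPT γ ξ '' K, ?_, ?_, image_subset_iff.2 fun u hu => (hKsub hu).1⟩
  · rw [← h.map_toPT_nhds]
    exact image_mem_map hK
  · exact (hK_compact.image_of_continuousOn (hcont.mono fun u hu => (hKsub hu).2)).isClosed

end IsLocalParam

/-- The front of a chart of `L` near a point over `γ u` meets `γ` at `γ u`; by Sard, it is tangent
to `γ` there for almost every `u`. -/
lemma IsBigLegendrian.ae_isConormal_of_leftInverse (hL : IsBigLegendrian L)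
    (γ : EuclideanSpace ℝ (Fin n) → SpaceTime n) (r : SpaceTime n → EuclideanSpace ℝ (Fin n)) :
    ∀ᵐ u, DifferentiableAt ℝ γ u → DifferentiableAt ℝ r (γ u) → r (γ u) = u →
      ∀ q ∈ L, q.1 = γ u → IsConormal q (fderiv ℝ γ u) := by
  have hlocal : ∀ p ∈ L, ∃ N ∈ 𝓝[L] p, ∀ᵐ u, DifferentiableAt ℝ γ u → DifferentiableAt ℝ r (γ u) →
      r (γ u) = u → ∀ q ∈ N, q.1 = γ u → IsConormal q (fderiv ℝ γ u) := by
    intro p hp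
    obtain ⟨O, v, γ', ξ, h, hLeg⟩ := hL p hp
    refine ⟨toPT γ' ξ '' O, ?_, ?_⟩
    · rw [← h.map_toPT_nhds]
      exact image_mem_map (h.isOpen.mem_nhds h.mem)
    · filter_upwards [ae_comp_fderiv_eq_zero_of_leftInverse volume (γ := γ) (r := r)
        (fun w hw => (h.contDiffAt_base hw).differentiableAt one_ne_zero)
        (fun w hw => ContinuousLinearMap.ext (hLeg w hw))] with u hu hγ hr hru
      rintro _ ⟨w, hw, rfl⟩ hwu
      exact (isConormal_mk _).2 (hu hγ hr hru w hw hwu)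
  choose! N hN hN_ae using hlocal
  obtain ⟨T, hTL, hT, hcover⟩ := TopologicalSpace.countable_cover_nhdsWithin hN
  filter_upwards [(ae_ball_iff hT).2 fun p hp => hN_ae p (hTL hp)] with u hu hγ hr hru q hq
  obtain ⟨p, hp, hqp⟩ := mem_iUnion₂.1 (hcover hq)
  exact hu p hp hγ hr hru q hqp

lemma IsBigLegendrian.ae_isConormal (hL : IsBigLegendrian L)
    {γ : EuclideanSpace ℝ (Fin n) → SpaceTime n} {u₀ : EuclideanSpace ℝ (Fin n)}
    (hγ : ContDiffAt ℝ 1 γ u₀) (hinj : Function.Injective (fderiv ℝ γ u₀)) :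
    ∀ᶠ u in 𝓝 u₀ ⊓ ae volume, ∀ q ∈ L, q.1 = γ u → IsConormal q (fderiv ℝ γ u) := by
  obtain ⟨a, ha⟩ := LinearMap.exists_leftInverse_of_injective
    (fderiv ℝ γ u₀ : EuclideanSpace ℝ (Fin n) →ₗ[ℝ] SpaceTime n) (LinearMap.ker_eq_bot.2 hinj)
  obtain ⟨r, hr, hrγ⟩ := exists_contDiffAt_leftInverse one_ne_zero hγ
    (a := LinearMap.toContinuousLinearMap a) (ContinuousLinearMap.coe_injective ha)
  have hγ_diff : ∀ᶠ u in 𝓝 u₀, DifferentiableAt ℝ γ u :=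
    (hγ.eventually (by simp)).mono fun u hu => hu.differentiableAt one_ne_zero
  have hr_diff : ∀ᶠ u in 𝓝 u₀, DifferentiableAt ℝ r (γ u) :=
    hγ.continuousAt.eventually
      ((hr.eventually (by simp)).mono fun z hz => hz.differentiableAt one_ne_zero)
  filter_upwards [(hγ_diff.and (hr_diff.and hrγ)).filter_mono inf_le_left,
    (hL.ae_isConormal_of_leftInverse γ r).filter_mono inf_le_right] with u ⟨hγu, hru, hrγu⟩ hu
  exact hu hγu hru hrγu

/-- Near a regular point `p`, almost every point of `L` and its partner in `L'` are both conormal to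
the image under `Φ` of the front of `L`, which is a hypersurface near `p`. -/
lemma mem_closure_eq_contactLift_of_mem_regularSet (hΦ : IsC1Diffeo Φ) (hL : IsBigLegendrian L)
    (hL' : IsBigLegendrian L') (hp : p ∈ regularSet L) (hpΦ : p.1 ∈ Φ.source) :
    p ∈ closure {r ∈ L | ∀ q ∈ L', q.1 = Φ r.1 → q = contactLift Φ r} := by
  obtain ⟨-, O, u₀, γ, ξ, h, hinj⟩ := hp
  obtain rfl : toPT γ ξ u₀ = p := h.map_eq
  have hγ := h.contDiffAt_base h.mem
  have hΦγ : ContDiffAt ℝ 1 (Φ ∘ γ) u₀ := (hΦ.contDiffAt hpΦ).comp u₀ hγ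
  have hinj' : Function.Injective (fderiv ℝ (Φ ∘ γ) u₀) := by
    rw [fderiv_comp u₀ (hΦ.differentiableAt hpΦ) (hγ.differentiableAt one_ne_zero)]
    exact (hΦ.injective_fderiv hpΦ).comp hinj
  have hsource : ∀ᶠ u in 𝓝 u₀, γ u ∈ Φ.source :=
    hγ.continuousAt.eventually_mem (Φ.open_source.mem_nhds hpΦ)
  have hinj_near : ∀ᶠ u in 𝓝 u₀, Function.Injective (fderiv ℝ (Φ ∘ γ) u) :=
    (hΦγ.continuousAt_fderiv one_ne_zero).eventually
      (ContinuousLinearMap.isOpen_injective.mem_nhds hinj')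
  have hmem : ∀ᶠ u in 𝓝 u₀, toPT γ ξ u ∈ L :=
    mem_map.1 (h.map_toPT_nhds ▸ self_mem_nhdsWithin)
  have htendsto : Tendsto (toPT γ ξ) (𝓝 u₀ ⊓ ae volume) (𝓝 (toPT γ ξ u₀)) :=
    (tendsto_inf_left h.map_toPT_nhds.le).mono_right nhdsWithin_le_nhds
  refine mem_closure_of_tendsto htendsto ?_
  filter_upwards [hL.ae_isConormal hγ hinj, hL'.ae_isConormal hΦγ hinj',
    ((hsource.and (hinj_near.and hmem)).and (h.isOpen.mem_nhds h.mem)).filter_mono inf_le_left]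
    with u hu hu' ⟨⟨hus, hui, huL⟩, huO⟩
  have hlift : IsConormal (contactLift Φ (toPT γ ξ u)) (fderiv ℝ (Φ ∘ γ) u) := by
    rw [fderiv_comp u (hΦ.differentiableAt hus)
      ((h.contDiffAt_base huO).differentiableAt one_ne_zero)]
    exact (hu _ huL rfl).contactLift hΦ hus
  exact ⟨huL, fun q hq hqu => (hu' q hq hqu).eq hlift finrank_euclideanSpace_fin hui
    (hqu.trans (hΦ.contactLift_fst hus).symm)⟩

/-- The germ of the big wave front of `(L, p)`, as the filter generated by the fronts of
arbitrarily small representatives of the Legendrian germ. -/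
noncomputable def frontGerm (L : Set (PT n)) (p : PT n) : Filter (SpaceTime n) :=
  map Prod.fst (𝓝[L] p)

lemma mem_frontGerm {T : Set (SpaceTime n)} :
    T ∈ frontGerm L p ↔ ∃ V ∈ 𝓝 p, bigWaveFront (L ∩ V) ⊆ T := by
  simp only [frontGerm, mem_map, mem_nhdsWithin_iff_exists_mem_nhds_inter, bigWaveFront,
    image_subset_iff, inter_comm L]

lemma bigWaveFront_mem_frontGerm {V : Set (PT n)} (hV : V ∈ 𝓝 p) :
    bigWaveFront (L ∩ V) ∈ frontGerm L p :=
  mem_frontGerm.2 ⟨V, hV, Subset.rfl⟩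

lemma frontGerm_le_nhds : frontGerm L p ≤ 𝓝 p.1 :=
  continuousAt_fst.mono_left nhdsWithin_le_nhds

lemma eventually_frontGerm_mem_source (hp : p.1 ∈ Φ.source) :
    ∀ᶠ z in frontGerm L p, z ∈ Φ.source :=
  frontGerm_le_nhds (Φ.open_source.mem_nhds hp)

lemma forall_exists_sameGerm_iff_map_frontGerm (hp₀ : p₀.1 ∈ Φ.source) (hΦp₀ : Φ p₀.1 = p₀'.1) :
    (∀ V ∈ 𝓝 p₀, ∀ V' ∈ 𝓝 p₀', ∃ U ∈ 𝓝 p₀, ∃ U' ∈ 𝓝 p₀', U ⊆ V ∧ U' ⊆ V' ∧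
      SameGerm p₀'.1 (Φ '' (bigWaveFront (L ∩ U) ∩ Φ.source)) (bigWaveFront (L' ∩ U'))) ↔
    map Φ (frontGerm L p₀) = frontGerm L' p₀' := by
  have himage : ∀ U ∈ 𝓝 p₀,
      Φ '' (bigWaveFront (L ∩ U) ∩ Φ.source) ∈ map Φ (frontGerm L p₀) := fun U hU =>
    image_mem_map (inter_mem (bigWaveFront_mem_frontGerm hU) (eventually_frontGerm_mem_source hp₀))
  constructor
  · intro h
    have hmap_le : map Φ (frontGerm L p₀) ≤ 𝓝 p₀'.1 :=
      hΦp₀ ▸ (Φ.continuousAt hp₀).mono_left frontGerm_le_nhds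
    refine le_antisymm (fun T hT => ?_) fun T hT => ?_
    · obtain ⟨V', hV', hVT⟩ := mem_frontGerm.1 hT
      obtain ⟨U, hU, U', -, -, hUV, hgerm⟩ := h univ univ_mem V' hV'
      filter_upwards [himage U hU, hmap_le hgerm] with z hz hz_iff
      exact hVT (image_mono (inter_subset_inter_right L' hUV) (hz_iff.1 hz))
    · obtain ⟨V, hV, hVT⟩ := mem_frontGerm.1 hT
      obtain ⟨U, -, U', hU', hUV, -, hgerm⟩ := h V hV univ univ_mem
      filter_upwards [bigWaveFront_mem_frontGerm hU', frontGerm_le_nhds hgerm] with z hz hz_iff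
      obtain ⟨w, ⟨hw, -⟩, rfl⟩ := hz_iff.2 hz
      exact hVT (image_mono (inter_subset_inter_right L hUV) hw)
  · intro h V hV V' hV'
    let A : Set (SpaceTime n) := Φ '' (bigWaveFront (L ∩ V) ∩ Φ.source)
    let B : Set (SpaceTime n) := bigWaveFront (L' ∩ V')
    have hA : A ∈ frontGerm L' p₀' := h ▸ himage V hV
    have hB : Φ ⁻¹' B ∈ frontGerm L p₀ := by
      rw [← mem_map, h]
      exact bigWaveFront_mem_frontGerm hV'
    refine ⟨V ∩ {p | p ∈ L → Φ p.1 ∈ B}, inter_mem hV (mem_nhdsWithin_iff_eventually.1 hB),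
      V' ∩ {q | q ∈ L' → q.1 ∈ A}, inter_mem hV' (mem_nhdsWithin_iff_eventually.1 hA),
      inter_subset_left, inter_subset_left, Eventually.of_forall fun z => ?_⟩
    constructor
    · rintro ⟨_, ⟨⟨p, ⟨hpL, hpV, hpB⟩, rfl⟩, hp⟩, rfl⟩
      obtain ⟨q, ⟨hqL, hqV⟩, hq⟩ := hpB hpL
      exact ⟨q, ⟨hqL, hqV, fun _ => ⟨p.1, ⟨⟨p, ⟨hpL, hpV⟩, rfl⟩, hp⟩, hq.symm⟩⟩, hq⟩
    · rintro ⟨q, ⟨hqL, hqV, hqA⟩, rfl⟩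
      obtain ⟨_, ⟨⟨p, ⟨hpL, hpV⟩, rfl⟩, hp⟩, hpq⟩ := hqA hqL
      exact ⟨p.1, ⟨⟨p, ⟨hpL, hpV, fun _ => ⟨q, ⟨hqL, hqV⟩, hpq.symm⟩⟩, rfl⟩, hp⟩, hpq⟩

lemma sameGerm_image_iff_map_nhdsWithin {X Y : Type*} [TopologicalSpace X] [TopologicalSpace Y]
    (e : OpenPartialHomeomorph X Y) {x : X} (hx : x ∈ e.source) (A : Set X) (B : Set Y) :
    SameGerm (e x) (e '' (A ∩ e.source)) B ↔ map e (𝓝[A] x) = 𝓝[B] (e x) := by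
  rw [e.map_nhdsWithin_eq hx, nhdsWithin_eq_iff_eventuallyEq, eventuallyEq_set, inter_comm,
    SameGerm]

lemma contactLift_eq_and_sameGerm_iff_map_nhdsWithin (hΦ : IsC1Diffeo Φ) (hp₀ : p₀ ∈ L)
    (hp₀Φ : p₀.1 ∈ Φ.source) :
    (contactLift Φ p₀ = p₀' ∧
      SameGerm p₀' (contactLift Φ '' (L ∩ {p | p.1 ∈ Φ.source})) L') ↔
    map (contactLift Φ) (𝓝[L] p₀) = 𝓝[L'] p₀' := by
  have hgerm : SameGerm (contactLift Φ p₀) (contactLift Φ '' (L ∩ {p | p.1 ∈ Φ.source})) L' ↔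
      map (contactLift Φ) (𝓝[L] p₀) = 𝓝[L'] (contactLift Φ p₀) :=
    sameGerm_image_iff_map_nhdsWithin hΦ.contactLiftHomeomorph hp₀Φ L L'
  constructor
  · rintro ⟨rfl, h⟩
    exact hgerm.1 h
  · intro h
    have hcont : Tendsto (contactLift Φ) (𝓝[L] p₀) (𝓝 (contactLift Φ p₀)) :=
      (hΦ.contactLiftHomeomorph.continuousAt hp₀Φ).mono_left nhdsWithin_le_nhds
    have := mem_closure_iff_nhdsWithin_neBot.1 (subset_closure hp₀)
    obtain rfl := tendsto_nhds_unique hcont (h.le.trans nhdsWithin_le_nhds)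
    exact ⟨rfl, hgerm.2 h⟩

lemma tendsto_contactLift_of_tendsto_frontGerm (hΦ : IsC1Diffeo Φ) (hL : IsBigLegendrian L)
    (hL' : IsBigLegendrian L') (hp₀' : p₀' ∈ L') (hreg : RegularDenseAt L p₀)
    (hp₀ : p₀.1 ∈ Φ.source) (h : Tendsto Φ (frontGerm L p₀) (frontGerm L' p₀')) :
    Tendsto (contactLift Φ) (𝓝[L] p₀) (𝓝[L'] p₀') := by
  obtain ⟨O, u₀, γ, ξ, hparam, -⟩ := hL' p₀' hp₀'
  have hsource : Prod.fst ⁻¹' Φ.source ∈ 𝓝 p₀ := continuousAt_fst (Φ.open_source.mem_nhds hp₀)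
  refine tendsto_nhdsWithin_of_closure_mem
    (R := {r ∈ L | ∀ q ∈ L', q.1 = Φ r.1 → q = contactLift Φ r})
    (fun S => hparam.exists_isClosed_subset) ?_ ?_ ?_
  · filter_upwards [hsource] with p hp using hΦ.contactLiftHomeomorph.continuousAt hp
  · obtain ⟨U, hU, hUreg⟩ := hreg
    filter_upwards [self_mem_nhdsWithin, mem_nhdsWithin_of_mem_nhds hU,
      mem_nhdsWithin_of_mem_nhds hsource] with p hpL hpU hpΦ
    have hp : p ∈ closure (Prod.fst ⁻¹' Φ.source ∩ regularSet L) :=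
      (Φ.open_source.preimage continuous_fst).inter_closure ⟨hpΦ, hUreg ⟨hpL, hpU⟩⟩
    exact closure_minimal
      (fun r hr => mem_closure_eq_contactLift_of_mem_regularSet hΦ hL hL' hr.2 hr.1)
      isClosed_closure hp
  · intro S hS
    change contactLift Φ ⁻¹' S ∈ 𝓝[_] p₀
    have hfront : ∀ᶠ r in 𝓝[L] p₀, Φ r.1 ∈ Prod.fst '' (S ∩ L') :=
      h (image_mem_map (inter_mem hS self_mem_nhdsWithin))
    filter_upwards [self_mem_nhdsWithin, hfront.filter_mono (nhdsWithin_mono p₀ (sep_subset L _))]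
      with r hr ⟨q, ⟨hqS, hqL⟩, hq⟩
    rwa [mem_preimage, ← hr.2 q hqL hq]

lemma map_contactLift_nhdsWithin_iff_map_frontGerm (hΦ : IsC1Diffeo Φ) (hL : IsBigLegendrian L)
    (hL' : IsBigLegendrian L') (hp₀ : p₀ ∈ L) (hp₀' : p₀' ∈ L') (hreg : RegularDenseAt L p₀)
    (hreg' : RegularDenseAt L' p₀') (hp₀Φ : p₀.1 ∈ Φ.source) (hΦp₀ : Φ p₀.1 = p₀'.1) :
    map (contactLift Φ) (𝓝[L] p₀) = 𝓝[L'] p₀' ↔ map Φ (frontGerm L p₀) = frontGerm L' p₀' := by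
  have hp₀'Φ : p₀'.1 ∈ Φ.symm.source := hΦp₀ ▸ Φ.map_source hp₀Φ
  have hsource : ∀ᶠ p in 𝓝[L] p₀, p.1 ∈ Φ.source := eventually_frontGerm_mem_source hp₀Φ
  have htarget : ∀ᶠ p in 𝓝[L'] p₀', p.1 ∈ Φ.target := eventually_frontGerm_mem_source hp₀'Φ
  constructor
  · intro h
    rw [frontGerm, frontGerm, ← h, map_map, map_map]
    exact map_congr (hsource.mono fun p hp => (hΦ.contactLift_fst hp).symm)
  · intro h
    have hsymm : Tendsto Φ.symm (frontGerm L' p₀') (frontGerm L p₀) := by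
      rw [← h, tendsto_map'_iff]
      exact tendsto_id.congr' ((eventually_frontGerm_mem_source hp₀Φ).mono
        fun z hz => (Φ.left_inv hz).symm)
    refine le_antisymm
      (tendsto_contactLift_of_tendsto_frontGerm hΦ hL hL' hp₀' hreg hp₀Φ h.le)
      (le_map_of_right_inverse ?_
        (tendsto_contactLift_of_tendsto_frontGerm hΦ.symm hL' hL hp₀ hreg' hp₀'Φ hsymm))
    exact htarget.mono fun q hq => hΦ.symm.contactLift_symm_contactLift hq

end BigFront

theorem proposition6p4_general {n : ℕ}
    {Φ : OpenPartialHomeomorph (BigFront.SpaceTime n) (BigFront.SpaceTime n)}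
    {L L' : Set (BigFront.PT n)} {p₀ p₀' : BigFront.PT n} (hΦ : BigFront.IsC1Diffeo Φ)
    (hp₀Φ : p₀.1 ∈ Φ.source) (hΦp₀ : Φ p₀.1 = p₀'.1)
    (hL : BigFront.IsBigLegendrian L) (hL' : BigFront.IsBigLegendrian L')
    (hp₀ : p₀ ∈ L) (hp₀' : p₀' ∈ L')
    (hreg : BigFront.RegularDenseAt L p₀) (hreg' : BigFront.RegularDenseAt L' p₀') :
    (BigFront.contactLift Φ p₀ = p₀' ∧
      BigFront.SameGerm p₀' (BigFront.contactLift Φ '' (L ∩ {p | p.1 ∈ Φ.source})) L') ↔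
    ∀ V ∈ 𝓝 p₀, ∀ V' ∈ 𝓝 p₀', ∃ U ∈ 𝓝 p₀, ∃ U' ∈ 𝓝 p₀', U ⊆ V ∧ U' ⊆ V' ∧
      BigFront.SameGerm p₀'.1 (Φ '' (BigFront.bigWaveFront (L ∩ U) ∩ Φ.source))
        (BigFront.bigWaveFront (L' ∩ U')) := by
  rw [BigFront.contactLift_eq_and_sameGerm_iff_map_nhdsWithin hΦ hp₀ hp₀Φ,
    BigFront.forall_exists_sameGerm_iff_map_frontGerm hp₀Φ hΦp₀]
  exact BigFront.map_contactLift_nhdsWithin_iff_map_frontGerm hΦ hL hL' hp₀ hp₀' hreg hreg'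
    hp₀Φ hΦp₀

theorem proposition6p4 (n : ℕ) (L L' : Set (BigFront.PT n)) (p₀ p₀' : BigFront.PT n)
    (hL : BigFront.IsBigLegendrian L) (hL' : BigFront.IsBigLegendrian L')
    (hp₀ : p₀ ∈ L) (hp₀' : p₀' ∈ L')
    (hreg : BigFront.RegularDenseAt L p₀) (hreg' : BigFront.RegularDenseAt L' p₀') :
    BigFront.SPLegendrianEquivalent L p₀ L' p₀' ↔
      BigFront.FrontsSPDiffeomorphic L p₀ L' p₀' :=
  exists_congr fun _ => and_congr_right fun hΦ =>
    proposition6p4_general hΦ.isC1Diffeo hΦ.mem_source hΦ.map_eq hL hL' hp₀ hp₀' hreg hreg'
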